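/- Let $G=(V,E)$ be a finite simple graph and $\omega$ an acyclic orientation of $G$. Write $P(G,\omega)$ for the poset on $V$ in which $i\le j$ iff $\omega$ has a directed path from $i$ to $j$ (possibly of length $0$), and $[\omega]$ for the class of $\omega$ under the equivalence relation on acyclic orientations of $G$ generated by converting a source into a sink (reversing all edges at it). A toric chamber of $G$ is a connected component of $\{x\in\mathbb{R}^V/\mathbb{Z}^V : x_i\neq x_j \text{ for all } \{i,j\}\in E\}$. A toric poset over $V$ is a subset $P$ of $\mathbb{R}^V/\mathbb{Z}^V$ that is a toric chamber of some graph on $V$. The toric poset $P(G,[\omega])$ is the toric chamber of $G$ whose points $x$ determine orientations in $[\omega]$, where $x$ directs an edge $\{i,j\}$ as $i\to j$ iff $x_i \bmod 1 < x_j \bmod 1$ (representatives in $[0,1)$). For a toric poset $P$ and a partition $\pi$ of $V$ let $D^{\mathrm{tor}}_\pi=\{x\in\mathbb{R}^V/\mathbb{Z}^V : x_i=x_j \text{ whenever } i,j \text{ lie in the same block of } \pi\}$, and let the closure of $\pi$ with respect to $P$ be the coarsest partition $\bar\pi$ coarsening $\pi$ with $\overline{P}\cap D^{\mathrm{tor}}_{\bar\pi}=\overline{P}\cap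 D^{\mathrm{tor}}_\pi$; the dimension of $\overline{P}\cap D^{\mathrm{tor}}_\pi$ is defined to be $\dim\{x\in\mathbb{R}^V : x_i=x_j \text{ whenever } i,j \text{ lie in the same block of } \bar\pi\}$. The partition $\pi$ is closed with respect to $P$ if $\bar\pi=\pi$. A subset $I\subseteq V$ is a toric filter (equivalently, a toric order ideal) of $P$ if the partition $\pi$ of $V$ whose blocks are the nonempty sets among $I$ and $V\setminus I$ is closed with respect to $P$ and $\overline{P}\cap D^{\mathrm{tor}}_\pi$ has dimension at most $2$. A total toric extension of $P$ is a toric chamber $P'\subseteq P$ of the complete graph on $V$; its cyclic order is the class, under cyclic rotation, of the list of all elements of $V$ in increasing order of their coordinates $x_i \bmod 1\in[0,1)$, which is the same for all $x\in P'$. Then for every subset $I\subseteq V$ the following are equivalent: 1. $I$ is a toric filter of $P(G,[\omega])$; 2. $I$ is an order ideal (down-closed subset) of $P(G,\omega')$ for some $\omega'\in[\omega]$; 3. $I$ is a filter (up-closed subset) of $P(G,\omega'')$ for some $\omega''\in[\omega]$; 4. there is a total toric extension of $P(G,[\omega])$ in whose cyclic order the elements of $I$ appear consecutively, i.e. some list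 in the cyclic class has exactly the elements of $I$ as an initial segment. -/

import Mathlib

/-- An acyclic orientation of a simple graph `G`: `arrow i j` means that the edge `{i, j}` is
directed `i → j`. Acyclicity excludes, in particular, that an edge is directed both ways. -/
@[ext]
structure AcyclicOrientation {V : Type*} (G : SimpleGraph V) where
  arrow : V → V → Prop
  adj_iff : ∀ i j, G.Adj i j ↔ arrow i j ∨ arrow j i
  acyclic : ∀ i, ¬ Relation.TransGen arrow i i

namespace AcyclicOrientation

variable {V : Type*} {G : SimpleGraph V}

/-- The poset `P(G, ω)` on `V`: `i ≤ j` iff there is a directed path (possibly of length zero)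
from `i` to `j`. -/
@[reducible]
def poset (ω : AcyclicOrientation G) : PartialOrder V where
  le := Relation.ReflTransGen ω.arrow
  le_refl _ := Relation.ReflTransGen.refl
  le_trans _ _ _ h₁ h₂ := h₁.trans h₂
  le_antisymm a b h₁ h₂ := by
    rcases Relation.reflTransGen_iff_eq_or_transGen.1 h₁ with h | h
    · exact h.symm
    · exact absurd (h.trans_left h₂) (ω.acyclic a)

/-- `I` is an order ideal (down-closed subset) of `P(G, ω)`. -/
def IsOrderIdeal (ω : AcyclicOrientation G) (I : Set V) : Prop :=
  @IsLowerSet V ω.poset.toLE I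

/-- `I` is a filter (up-closed subset) of `P(G, ω)`. -/
def IsOrderFilter (ω : AcyclicOrientation G) (I : Set V) : Prop :=
  @IsUpperSet V ω.poset.toLE I

/-- `ω'` is obtained from `ω` by converting a source `v` into a sink: all edges at `v` are
reversed, all other edges keep their direction. -/
def IsFlip (ω ω' : AcyclicOrientation G) : Prop :=
  ∃ v : V, (∀ u, ¬ ω.arrow u v) ∧
    ∀ i j, ω'.arrow i j ↔
      ((i ≠ v ∧ j ≠ v) ∧ ω.arrow i j) ∨ ((i = v ∨ j = v) ∧ ω.arrow j i)

/-- Toric equivalence `ω ≡ ω'`: the equivalence relation generated by source-to-sink flips. -/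
def ToricEquiv (ω ω' : AcyclicOrientation G) : Prop :=
  Relation.EqvGen IsFlip ω ω'

/-- The toric equivalence class `[ω]`. -/
def toricClass (ω : AcyclicOrientation G) : Set (AcyclicOrientation G) :=
  {ω' | ToricEquiv ω ω'}

end AcyclicOrientation

/-- The torus `ℝ^V / ℤ^V = (ℝ / ℤ)^V`, with its product topology. -/
abbrev Torus (V : Type*) : Type _ := V → UnitAddCircle

namespace Torus

variable {V : Type*}

/-- The representative in `[0, 1)` of the coordinate `x_i` of a point of the torus. -/
noncomputable def modOne (x : Torus V) (i : V) : ℝ :=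
  (AddCircle.equivIco (1 : ℝ) 0 (x i) : ℝ)

/-- The complement in the torus of the toric graphic arrangement of `G`, that is of the union of
the toric hyperplanes `{x | x_i = x_j mod 1}` over the edges `{i, j}` of `G`. -/
def arrangementCompl (G : SimpleGraph V) : Set (Torus V) :=
  {x | ∀ i j, G.Adj i j → x i ≠ x j}

/-- The toric chambers of `G`: the connected components of the complement of the toric graphic
arrangement. -/
def chambers (G : SimpleGraph V) : Set (Set (Torus V)) :=
  {c | ∃ x ∈ arrangementCompl G, c = connectedComponentIn (arrangementCompl G) x}

/-- The acyclic orientation of `G` determined by a point `x` off the toric arrangement: the edge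
`{i, j}` is directed `i → j` iff `x_i mod 1 < x_j mod 1`. -/
noncomputable def orientation (G : SimpleGraph V) (x : Torus V) (hx : x ∈ arrangementCompl G) :
    AcyclicOrientation G where
  arrow i j := G.Adj i j ∧ modOne x i < modOne x j
  adj_iff i j := by
    constructor
    · intro h
      have hne : modOne x i ≠ modOne x j := fun he =>
        hx i j h ((AddCircle.equivIco (1 : ℝ) 0).injective (Subtype.ext he))
      rcases lt_or_gt_of_ne hne with h' | h'
      · exact Or.inl ⟨h, h'⟩
      · exact Or.inr ⟨h.symm, h'⟩
    · rintro (h | h)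
      · exact h.1
      · exact h.1.symm
  acyclic i h := by
    have key : ∀ a b, Relation.TransGen
        (fun i j => G.Adj i j ∧ modOne x i < modOne x j) a b → modOne x a < modOne x b := by
      intro a b hab
      induction hab with
      | single h => exact h.2
      | tail _ h ih => exact ih.trans h.2
    exact lt_irrefl _ (key i i h)

/-- The set `D_π` in the torus: the coordinates are equal within each block of the partition
`π`. -/
def flat (π : Setoid V) : Set (Torus V) :=
  {x | ∀ i j, π i j → x i = x j}

/-- The central preimage in `ℝ^V` of `Torus.flat π`. -/
def centralFlat (π : Setoid V) : Submodule ℝ (V → ℝ) where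
  carrier := {x | ∀ i j, π i j → x i = x j}
  zero_mem' _ _ _ := rfl
  add_mem' ha hb i j h := congrArg₂ (· + ·) (ha i j h) (hb i j h)
  smul_mem' c _ ha i j h := congrArg (c * ·) (ha i j h)

end Torus

/-- A toric poset over `V`: a subset of the torus that is a toric chamber of at least one graph on
`V`. -/
structure ToricPoset (V : Type*) where
  chamber : Set (Torus V)
  exists_graph : ∃ G : SimpleGraph V, chamber ∈ Torus.chambers G

namespace ToricPoset

variable {V : Type*}

/-- `P = P(G, [ω])`: the toric poset `P` is a toric chamber of `G`, and the map sending a chamber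
to the toric equivalence class of the orientations determined by its points sends it to `[ω]`. -/
def IsToricPosetOf (P : ToricPoset V) (G : SimpleGraph V) (ω : AcyclicOrientation G) : Prop :=
  P.chamber ∈ Torus.chambers G ∧
    ∃ (x : Torus V) (hx : x ∈ Torus.arrangementCompl G),
      x ∈ P.chamber ∧ Torus.orientation G x hx ∈ ω.toricClass

/-- The intersection of the closed toric chamber of `P` with the flat of the partition `π`. -/
def closedFace (P : ToricPoset V) (π : Setoid V) : Set (Torus V) :=
  closure P.chamber ∩ Torus.flat π

/-- The closure of the partition `π` with respect to `P`: the join, in the lattice of partitions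
(ordered by coarsening), of all coarsenings `σ` of `π` with the same `closedFace` as `π`. -/
def closurePartition (P : ToricPoset V) (π : Setoid V) : Setoid V :=
  sSup {σ | π ≤ σ ∧ P.closedFace σ = P.closedFace π}

/-- The partition `π` is closed with respect to `P`. -/
def IsClosedPartition (P : ToricPoset V) (π : Setoid V) : Prop :=
  P.closurePartition π = π

/-- The dimension of `closedFace P π`: the dimension of the central preimage of the flat of the
closure of `π`. -/
noncomputable def faceDim (P : ToricPoset V) (π : Setoid V) : ℕ :=
  Module.finrank ℝ (Torus.centralFlat (P.closurePartition π))

/-- `I` is a toric filter (equivalently, toric order ideal) of `P`: the partition of `V` into the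
nonempty sets among `I` and `V \ I` is closed with respect to `P`, and its flat meets the closed
toric chamber in dimension at most two. -/
def IsToricFilter (P : ToricPoset V) (I : Set V) : Prop :=
  ∃ π : Setoid V, (∀ i j, π i j ↔ (i ∈ I ↔ j ∈ I)) ∧ P.IsClosedPartition π ∧ P.faceDim π ≤ 2

/-- `P'` is a total toric order: its chamber is a chamber for the complete graph. -/
def IsTotal (P' : ToricPoset V) : Prop :=
  P'.chamber ∈ Torus.chambers (⊤ : SimpleGraph V)

/-- `P'` is a total toric extension of `P`. -/
def IsTotalExtension (P' P : ToricPoset V) : Prop :=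
  P'.IsTotal ∧ P'.chamber ⊆ P.chamber

/-- The cyclic equivalence class `w` of lists is the cyclic order on `V` given by the total toric
order `P'`: for every point `x` of the chamber, some list in the class `w` consists of all elements
of `V` in strictly increasing order of their coordinates modulo one. -/
def HasCyclicOrder (P' : ToricPoset V) (w : Cycle V) : Prop :=
  ∀ x ∈ P'.chamber, ∃ l : List V, (l : Cycle V) = w ∧ (∀ v, v ∈ l) ∧
    l.Pairwise (fun i j => Torus.modOne x i < Torus.modOne x j)

end ToricPoset

/-- The elements of `I` appear consecutively in the cyclic order `w`: some list in the class `w`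
has exactly the elements of `I` in an initial segment. -/
def Cycle.IsConsecutive {V : Type*} (w : Cycle V) (I : Set V) : Prop :=
  ∃ l₁ l₂ : List V, ((l₁ ++ l₂ : List V) : Cycle V) = w ∧
    (∀ v ∈ l₁, v ∈ I) ∧ (∀ v ∈ l₂, v ∉ I)

/-! Condition 2 is the hub: every other condition is compared with being an order ideal of some
orientation in the class.

On the combinatorial side, reversing all edges between an order ideal and its complement amounts to
flipping the elements of the ideal one at a time (`toricEquiv_flipAcross`). This turns ideals into
filters within a class, giving 2 ↔ 3.

On the geometric side, chambers of `G` correspond to toric classes. A diagonal translation pushes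
some coordinates past 1, which flips the orientation across an order ideal. Hence the class is
locally constant on the complement of the arrangement
(`toricEquiv_orientation_of_mem_connectedComponentIn`). Conversely, the points inducing one
orientation form a connected set, and a flip is realized by a translation
(`connectedComponentIn_eq_of_toricEquiv`).

Now let `I` be an order ideal of an orientation in the class. Squeezing a labelling so that `I` lies
just above 1/4 and its complement just above 1/2 stays in the chamber. The limit is a point of the
closed face that separates the two blocks (2 → 1), and an unsqueezed injective version is a total
extension (2 → 4). Conversely, near a face point with two distinct values, a translate has `I` below
1/2 and the rest above (1 → 2). A cyclic order starting with `I` becomes linear after flipping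
across an initial segment (4 → 2). -/

namespace AcyclicOrientation

variable {V : Type*} {G : SimpleGraph V}

/-! ### Order ideals, filters and flips of acyclic orientations. -/

theorem arrow_asymm (ω : AcyclicOrientation G) {i j : V} (h : ω.arrow i j) : ¬ ω.arrow j i :=
  fun h' => ω.acyclic i (.tail (.single h) h')

theorem arrow_irrefl (ω : AcyclicOrientation G) (i : V) : ¬ ω.arrow i i :=
  fun h => ω.acyclic i (.single h)

theorem isOrderIdeal_iff {ω : AcyclicOrientation G} {I : Set V} :
    ω.IsOrderIdeal I ↔ ∀ i j, ω.arrow i j → j ∈ I → i ∈ I := by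
  constructor
  · intro h i j hij hj
    exact h (Relation.ReflTransGen.single hij) hj
  · intro h b a (hab : Relation.ReflTransGen ω.arrow a b) hb
    induction hab with
    | refl => exact hb
    | tail _ h' ih => exact ih (h _ _ h' hb)

theorem isOrderFilter_iff {ω : AcyclicOrientation G} {I : Set V} :
    ω.IsOrderFilter I ↔ ∀ i j, ω.arrow i j → i ∈ I → j ∈ I := by
  constructor
  · intro h i j hij hi
    exact h (Relation.ReflTransGen.single hij) hi
  · intro h a b (hab : Relation.ReflTransGen ω.arrow a b) ha
    induction hab with
    | refl => exact ha
    | tail _ h' ih => exact h _ _ h' ih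

theorem isOrderFilter_iff_compl {ω : AcyclicOrientation G} {I : Set V} :
    ω.IsOrderFilter I ↔ ω.IsOrderIdeal Iᶜ := by
  rw [isOrderFilter_iff, isOrderIdeal_iff]
  exact forall₃_congr fun i j _ => by simp only [Set.mem_compl_iff]; tauto

/-- An acyclic orientation is determined by any acyclic orientation whose arrows it contains. -/
theorem eq_of_arrow_imp {ω ω' : AcyclicOrientation G} (h : ∀ i j, ω.arrow i j → ω'.arrow i j) :
    ω = ω' := by
  ext i j
  refine ⟨h i j, fun hij => ?_⟩
  rcases (ω.adj_iff i j).1 ((ω'.adj_iff i j).2 (Or.inl hij)) with h' | h'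
  · exact h'
  · exact absurd (h _ _ h') (ω'.arrow_asymm hij)

/-- Reversing all edges between an order ideal and its complement. -/
def flipAcross (ω : AcyclicOrientation G) (I : Set V) (hI : ω.IsOrderIdeal I) :
    AcyclicOrientation G where
  arrow i j := ((i ∈ I ↔ j ∈ I) ∧ ω.arrow i j) ∨ (¬ (i ∈ I ↔ j ∈ I) ∧ ω.arrow j i)
  adj_iff i j := by
    rw [ω.adj_iff]
    tauto
  acyclic i h := by
    have hI' := isOrderIdeal_iff.1 hI
    -- Reversed arrows all lead from outside `I` into `I`, so a path can enter `I` but never leave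
    -- it. A path with both ends on the same side therefore uses only original arrows.
    have key : ∀ a b, Relation.TransGen (fun i j => ((i ∈ I ↔ j ∈ I) ∧ ω.arrow i j) ∨
        (¬ (i ∈ I ↔ j ∈ I) ∧ ω.arrow j i)) a b →
        (a ∈ I → b ∈ I) ∧ ((a ∈ I ↔ b ∈ I) → Relation.TransGen ω.arrow a b) := by
      intro a b hab
      induction hab with
      | @single c h =>
        have := hI' c a
        exact ⟨by tauto, fun h' => .single (by tauto)⟩
      | @tail b c _ h ih =>
        have := hI' c b
        refine ⟨by tauto, fun h' => (ih.2 (by tauto)).tail (by tauto)⟩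
    exact ω.acyclic i ((key i i h).2 Iff.rfl)

theorem isOrderFilter_flipAcross (ω : AcyclicOrientation G) (I : Set V) (hI : ω.IsOrderIdeal I) :
    (ω.flipAcross I hI).IsOrderFilter I := by
  rw [isOrderFilter_iff]
  intro i j h
  have := isOrderIdeal_iff.1 hI j i
  simp only [flipAcross] at h
  tauto

/-- Induction on the size of `I`: flip across `I` minus a maximal element `v`, then flip `v`. -/
theorem toricEquiv_flipAcross [Finite V] (ω : AcyclicOrientation G) (I : Set V)
    (hI : ω.IsOrderIdeal I) : ToricEquiv ω (ω.flipAcross I hI) := by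
  induction hn : I.ncard generalizing I with
  | zero =>
    have h0 : I = ∅ := (Set.ncard_eq_zero (Set.toFinite I)).1 hn
    have : ω = ω.flipAcross I hI := eq_of_arrow_imp fun i j h => by simp [flipAcross, h0, h]
    rw [← this]
    exact .refl _
  | succ n ih =>
    have hne : I.Nonempty := Set.nonempty_of_ncard_ne_zero (by omega)
    obtain ⟨v, hv, hmax⟩ : ∃ v ∈ I, ∀ u ∈ I, ¬ ω.arrow v u := by
      let := ω.poset
      obtain ⟨v, hv⟩ := (Set.toFinite I).exists_maximal hne
      refine ⟨v, hv.1, fun u hu h => ?_⟩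
      have hle : v ≤ u := Relation.ReflTransGen.single h
      have : v = u := le_antisymm hle (hv.2 hu hle)
      exact ω.arrow_irrefl v (this ▸ h)
    have hI' := isOrderIdeal_iff.1 hI
    have hJ : ω.IsOrderIdeal (I \ {v}) := by
      rw [isOrderIdeal_iff]
      rintro i j hij ⟨hj, hjv⟩
      refine ⟨hI' i j hij hj, ?_⟩
      rintro rfl
      exact hmax j hj hij
    have h1 := ih (I \ {v}) hJ (by rw [Set.ncard_sdiff_singleton_of_mem hv]; omega)
    -- `v` is now a source: maximality rules out arrows into it from the reversed part, and
    -- down-closure of `I` rules out arrows from outside `I`.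
    refine h1.trans _ _ _ (.rel _ _ ⟨v, ?_, ?_⟩)
    · intro u h
      have h2 := hmax u
      have h3 := hI' u v
      have h4 := ω.arrow_irrefl v
      by_cases huv : u = v
      · subst huv; simp [flipAcross] at h; exact h4 h
      · simp [flipAcross, huv] at h
        tauto
    · intro i j
      have h4 := ω.arrow_irrefl v
      by_cases hiv : i = v <;> by_cases hjv : j = v
      · subst hiv; subst hjv; simp [flipAcross]
      · subst hiv; simp [flipAcross, hjv, hv]; tauto
      · subst hjv; simp [flipAcross, hiv, hv]; tauto
      · simp [flipAcross, hiv, hjv]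

theorem exists_isOrderIdeal_iff_exists_isOrderFilter [Finite V] (ω : AcyclicOrientation G)
    (I : Set V) :
    (∃ ω' ∈ ω.toricClass, ω'.IsOrderIdeal I) ↔ ∃ ω' ∈ ω.toricClass, ω'.IsOrderFilter I := by
  constructor
  · rintro ⟨ω', hω, hI⟩
    exact ⟨_, hω.trans _ _ _ (ω'.toricEquiv_flipAcross I hI), ω'.isOrderFilter_flipAcross I hI⟩
  · rintro ⟨ω', hω, hI⟩
    rw [isOrderFilter_iff_compl] at hI
    refine ⟨_, hω.trans _ _ _ (ω'.toricEquiv_flipAcross _ hI), ?_⟩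
    have := ω'.isOrderFilter_flipAcross _ hI
    rwa [isOrderFilter_iff_compl, compl_compl] at this

/-- Every acyclic orientation of a finite graph is induced by an injective labelling. -/
theorem exists_injective_labelling [Finite V] (ω : AcyclicOrientation G) :
    ∃ g : V → ℝ, Function.Injective g ∧ (∀ i, g i ∈ Set.Ico (0 : ℝ) 1) ∧
      ∀ i j, ω.arrow i j → g i < g j := by
  let := ω.poset
  have := Fintype.ofFinite V
  let : Fintype (LinearExtension V) := ‹Fintype V›
  let e := (monoEquivOfFin (LinearExtension V) rfl).symm
  let k : V → Fin (Fintype.card (LinearExtension V)) := fun i => e (toLinearExtension i)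
  have hk : Function.Injective k := fun i j h => e.injective h
  have hpos : ∀ i : V, (0 : ℝ) < Fintype.card (LinearExtension V) := fun i =>
    Nat.cast_pos.2 (Fintype.card_pos_iff.2 ⟨(i : V)⟩)
  -- The label is the position in a linear extension of the poset, scaled into `[0, 1)`.
  refine ⟨fun i => (k i : ℕ) / (Fintype.card (LinearExtension V) : ℝ), ?_, ?_, ?_⟩
  · intro i j h
    have h' := (div_left_inj' (hpos i).ne').1 h
    exact hk (Fin.ext (Nat.cast_injective h'))
  · intro i
    refine ⟨by positivity, (div_lt_one (hpos i)).2 (Nat.cast_lt.2 (k i).2)⟩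
  · intro i j hij
    refine (div_lt_div_iff_of_pos_right (hpos i)).2 (Nat.cast_lt.2 ?_)
    have hle : i ≤ j := Relation.ReflTransGen.single hij
    have h1 : k i ≤ k j := e.monotone (toLinearExtension.monotone hle)
    refine lt_of_le_of_ne h1 fun h => ?_
    have : i = j := hk (Fin.ext h)
    exact ω.arrow_irrefl i (by rwa [← this] at hij)

/-- For orientations of the complete graph, the cyclic order of the vertices is invariant under
flips. -/
theorem exists_sorted_list_congr {w : Cycle V} {α β : AcyclicOrientation (⊤ : SimpleGraph V)}
    (h : ToricEquiv α β) :
    (∃ l : List V, (l : Cycle V) = w ∧ (∀ v, v ∈ l) ∧ l.Pairwise α.arrow) ↔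
      ∃ l : List V, (l : Cycle V) = w ∧ (∀ v, v ∈ l) ∧ l.Pairwise β.arrow := by
  induction h with
  | refl => exact Iff.rfl
  | symm _ _ _ ih => exact ih.symm
  | trans _ _ _ _ _ ih₁ ih₂ => exact ih₁.trans ih₂
  | rel α β h =>
    obtain ⟨v, hv, hflip⟩ := h
    constructor
    · rintro ⟨l, rfl, hl, hp⟩
      obtain ⟨s, t, rfl⟩ := List.append_of_mem (hl v)
      rw [List.pairwise_append] at hp
      obtain ⟨-, h2, h3⟩ := hp
      -- A source of a tournament heads the sorted list; the flip moves it to the end, which is a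
      -- cyclic rotation.
      have hs : s = [] := List.eq_nil_iff_forall_not_mem.2 fun u hu => hv u (h3 u hu v (by simp))
      subst hs
      rw [List.pairwise_cons] at h2
      have hne : ∀ u ∈ t, u ≠ v := fun u hu h => α.arrow_irrefl v (h ▸ h2.1 u hu)
      refine ⟨t ++ [v], Cycle.coe_eq_coe.2 ⟨t.length, by simp⟩,
        fun u => by simpa [or_comm] using hl u, ?_⟩
      rw [List.pairwise_append]
      refine ⟨h2.2.imp_of_mem fun {a b} ha hb hab => (hflip a b).2 (Or.inl ⟨⟨hne a ha, hne b hb⟩,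
        hab⟩), by simp, ?_⟩
      intro a ha b hb
      obtain rfl : b = v := by simpa using hb
      exact (hflip a b).2 (Or.inr ⟨Or.inr rfl, h2.1 a ha⟩)
    · rintro ⟨l, rfl, hl, hp⟩
      obtain ⟨s, t, rfl⟩ := List.append_of_mem (hl v)
      rw [List.pairwise_append, List.pairwise_cons] at hp
      obtain ⟨h1, h2, h3⟩ := hp
      have hv' : ∀ u, ¬ β.arrow v u := fun u h => by
        rcases (hflip v u).1 h with h | h
        · exact h.1.1 rfl
        · exact hv u h.2
      have ht : t = [] := List.eq_nil_iff_forall_not_mem.2 fun u hu => hv' u (h2.1 u hu)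
      subst ht
      have hne : ∀ u ∈ s, u ≠ v := fun u hu h => β.arrow_irrefl v (h ▸ h3 u hu v (by simp))
      refine ⟨v :: s, Cycle.coe_eq_coe.2 ⟨1, by simp⟩,
        fun u => by simpa [or_comm] using hl u, ?_⟩
      rw [List.pairwise_cons]
      constructor
      · intro u hu
        rcases (hflip u v).1 (h3 u hu v (by simp)) with h | h
        · exact absurd rfl h.1.2
        · exact h.2
      · refine h1.imp_of_mem fun {a b} ha hb hab => ?_
        rcases (hflip a b).1 hab with h | h
        · exact h.2
        · exact absurd h.1 (by simp [hne a ha, hne b hb])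

end AcyclicOrientation

/-! ### Coordinates modulo one and diagonal translations. -/

namespace Torus

variable {V : Type*} {G : SimpleGraph V}

theorem modOne_mem_Ico (x : Torus V) (i : V) : modOne x i ∈ Set.Ico (0 : ℝ) 1 := by
  simpa only [zero_add] using! (AddCircle.equivIco (1 : ℝ) 0 (x i)).2

theorem coe_modOne (x : Torus V) (i : V) : (modOne x i : UnitAddCircle) = x i :=
  AddCircle.coe_equivIco

theorem modOne_eq {x : Torus V} {i : V} {r : ℝ} (hr : r ∈ Set.Ico (0 : ℝ) 1)
    (h : (r : UnitAddCircle) = x i) : modOne x i = r := by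
  have hr' : r ∈ Set.Ico (0 : ℝ) (0 + 1) := by rwa [zero_add]
  rw [modOne, ← h, AddCircle.equivIco_coe_eq hr']

theorem continuousAt_modOne {x : Torus V} {i : V} (h : x i ≠ 0) :
    ContinuousAt (fun y : Torus V => modOne y i) x := by
  have h1 : ContinuousAt (AddCircle.equivIco (1 : ℝ) 0) (x i) :=
    AddCircle.continuousAt_equivIco 1 0 (by simpa using h)
  exact continuousAt_subtype_val.comp
    (ContinuousAt.comp (f := fun y : Torus V => y i) h1 (continuous_apply i).continuousAt)

/-- The image in the torus of a real vector. -/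
def ofReal (f : V → ℝ) : Torus V := fun i => (f i : UnitAddCircle)

theorem continuous_ofReal : Continuous (ofReal : (V → ℝ) → Torus V) :=
  continuous_pi fun i => (AddCircle.continuous_mk' 1).comp (continuous_apply i)

theorem modOne_ofReal {f : V → ℝ} {i : V} (hf : f i ∈ Set.Ico (0 : ℝ) 1) :
    modOne (ofReal f) i = f i :=
  modOne_eq hf rfl

theorem ofReal_modOne (x : Torus V) : ofReal (modOne x) = x :=
  funext fun i => coe_modOne x i

/-- Translation of a point of the torus along the diagonal. -/
def rotate (x : Torus V) (c : UnitAddCircle) : Torus V := fun i => x i + c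

theorem rotate_mem_arrangementCompl {x : Torus V} (hx : x ∈ arrangementCompl G)
    (c : UnitAddCircle) : rotate x c ∈ arrangementCompl G :=
  fun i j hij h => hx i j hij (add_right_cancel h)

theorem continuous_rotate_left (c : UnitAddCircle) :
    Continuous (fun x : Torus V => rotate x c) :=
  continuous_pi fun i => (continuous_apply i).add continuous_const

theorem modOne_rotate (x : Torus V) {c : ℝ} (hc : c ∈ Set.Ico (0 : ℝ) 1) (i : V) :
    modOne (rotate x c) i =
      if modOne x i < 1 - c then modOne x i + c else modOne x i + c - 1 := by
  have h := modOne_mem_Ico x i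
  obtain ⟨h1, h2⟩ := h
  obtain ⟨h3, h4⟩ := hc
  split_ifs with h5
  · refine modOne_eq ⟨by linarith, by linarith⟩ ?_
    rw [AddCircle.coe_add, coe_modOne]
    rfl
  · refine modOne_eq ⟨by linarith, by linarith⟩ ?_
    rw [AddCircle.coe_sub, AddCircle.coe_add, coe_modOne, AddCircle.coe_period, sub_zero]
    rfl

/-- Translating by `r` in `[0, 1)` wraps exactly the coordinates that are at least `1 - r`. The
remaining vertices form an order ideal, and the new orientation is the flip across it. -/
theorem toricEquiv_orientation_rotate [Finite V] {x : Torus V} (hx : x ∈ arrangementCompl G)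
    (c : UnitAddCircle) :
    (orientation G x hx).ToricEquiv
      (orientation G (rotate x c) (rotate_mem_arrangementCompl hx c)) := by
  obtain ⟨r, hr, rfl⟩ : ∃ r ∈ Set.Ico (0 : ℝ) 1, (r : UnitAddCircle) = c :=
    ⟨modOne (fun _ : Unit => c) (), modOne_mem_Ico _ _, coe_modOne (fun _ : Unit => c) ()⟩
  have hI : (orientation G x hx).IsOrderIdeal {i | modOne x i < 1 - r} :=
    AcyclicOrientation.isOrderIdeal_iff.2 fun i j hij hj => hij.2.trans hj
  have key : (orientation G x hx).flipAcross _ hI =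
      orientation G (rotate x r) (rotate_mem_arrangementCompl hx r) := by
    refine AcyclicOrientation.eq_of_arrow_imp fun i j hij => ?_
    have hi := modOne_mem_Ico x i
    have hj := modOne_mem_Ico x j
    simp only [AcyclicOrientation.flipAcross, orientation, Set.mem_ofPred_eq] at hij ⊢
    rw [modOne_rotate x hr, modOne_rotate x hr]
    rcases hij with ⟨h1, h2, h3⟩ | ⟨h1, h2, h3⟩
    · refine ⟨h2, ?_⟩
      split_ifs with h4 h5 h6
      · linarith
      · exact absurd (h1.1 h4) h5
      · exact absurd (h1.2 h6) h4
      · linarith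
    · refine ⟨h2.symm, ?_⟩
      split_ifs with h4 h5 h6
      · exact absurd ⟨fun _ => h5, fun _ => h4⟩ h1
      · linarith [hi.2]
      · linarith [hi.2, hj.1]
      · exact absurd ⟨fun h => absurd h h4, fun h => absurd h h6⟩ h1
  rw [← key]
  exact AcyclicOrientation.toricEquiv_flipAcross _ _ hI

theorem rotate_mem_connectedComponentIn {x : Torus V} (hx : x ∈ arrangementCompl G)
    (c : UnitAddCircle) : rotate x c ∈ connectedComponentIn (arrangementCompl G) x := by
  have h : IsPreconnected (Set.range fun c : UnitAddCircle => rotate x c) :=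
    isPreconnected_range (continuous_pi fun i => continuous_const.add continuous_id)
  refine h.subset_connectedComponentIn ⟨0, ?_⟩ ?_ ⟨c, rfl⟩
  · exact funext fun i => add_zero _
  · rintro _ ⟨c, rfl⟩
    exact rotate_mem_arrangementCompl hx c

/-- Serves to move every coordinate away from 0, the only point where `modOne` jumps. -/
theorem exists_rotate_ne_zero [Finite V] (x : Torus V) :
    ∃ c : UnitAddCircle, ∀ i, rotate x c i ≠ 0 := by
  have : Infinite UnitAddCircle :=
    (AddCircle.equivIco (1 : ℝ) 0).infinite_iff.2 (Set.Ico_infinite (by norm_num)).to_subtype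
  obtain ⟨c, hc⟩ := (Set.finite_range fun i => - x i).exists_notMem
  exact ⟨c, fun i h => hc ⟨i, neg_eq_of_add_eq_zero_right h⟩⟩

/-! ### Toric chambers correspond to toric classes. -/

/-- After a translation off 0 the coordinates are continuous, so strict inequalities persist and the
orientation is locally constant. The translation itself costs only a toric equivalence. -/
theorem eventually_toricEquiv_orientation [Finite V] {x : Torus V}
    (hx : x ∈ arrangementCompl G) :
    ∀ᶠ y in nhds x, ∀ hy : y ∈ arrangementCompl G,
      (orientation G x hx).ToricEquiv (orientation G y hy) := by
  obtain ⟨c, hc⟩ := exists_rotate_ne_zero x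
  have hcont : ∀ i, ContinuousAt (fun y => modOne (rotate y c) i) x := fun i =>
    ContinuousAt.comp (f := fun y => rotate y c) (continuousAt_modOne (hc i))
      (continuous_rotate_left c).continuousAt
  have key : ∀ᶠ y in nhds x, ∀ i j, modOne (rotate x c) i < modOne (rotate x c) j →
      modOne (rotate y c) i < modOne (rotate y c) j := by
    refine Filter.eventually_all.2 fun i => Filter.eventually_all.2 fun j => ?_
    by_cases h : modOne (rotate x c) i < modOne (rotate x c) j
    · filter_upwards [(hcont i).eventually_lt (hcont j) h] with y hy _ using hy
    · exact .of_forall fun y h' => absurd h' h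
  filter_upwards [key] with y hy hyG
  have heq : orientation G (rotate x c) (rotate_mem_arrangementCompl hx c) =
      orientation G (rotate y c) (rotate_mem_arrangementCompl hyG c) :=
    AcyclicOrientation.eq_of_arrow_imp fun i j h => ⟨h.1, hy i j h.2⟩
  have h1 := toricEquiv_orientation_rotate hx c
  rw [heq] at h1
  exact h1.trans _ _ _ ((toricEquiv_orientation_rotate hyG c).symm _ _)

/-- Points of the same toric chamber determine torically equivalent orientations. -/
theorem toricEquiv_orientation_of_mem_connectedComponentIn [Finite V] {x y : Torus V}
    (hx : x ∈ arrangementCompl G) (hy : y ∈ arrangementCompl G)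
    (h : y ∈ connectedComponentIn (arrangementCompl G) x) :
    (orientation G x hx).ToricEquiv (orientation G y hy) := by
  have hsub := connectedComponentIn_subset (arrangementCompl G) x
  refine (isPreconnected_connectedComponentIn (F := arrangementCompl G) (x := x)).induction₂
    (fun a b => ∀ (ha : a ∈ arrangementCompl G) (hb : b ∈ arrangementCompl G),
      (orientation G a ha).ToricEquiv (orientation G b hb)) ?_ ?_ ?_
    (mem_connectedComponentIn hx) h hx hy
  · intro a ha
    filter_upwards [nhdsWithin_le_nhds (eventually_toricEquiv_orientation (hsub ha))] with b hb
    exact fun _ hb' => hb hb'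
  · intro a b c _ hb _ hab hbc ha hc
    exact (hab ha (hsub hb)).trans _ _ _ (hbc (hsub hb) hc)
  · intro a b _ _ hab hb ha
    exact (hab ha hb).symm _ _

/-- The points of the torus that determine the orientation `ω`. -/
def realizations (ω : AcyclicOrientation G) : Set (Torus V) :=
  {x | ∃ hx : x ∈ arrangementCompl G, orientation G x hx = ω}

theorem ofReal_mem_realizations {ω : AcyclicOrientation G} {f : V → ℝ}
    (hf : ∀ i, f i ∈ Set.Ico (0 : ℝ) 1) (h : ∀ i j, ω.arrow i j → f i < f j) :
    ofReal f ∈ realizations ω := by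
  have hx : ofReal f ∈ arrangementCompl G := by
    intro i j hij he
    have he' : f i = f j := by
      rw [← modOne_ofReal (hf i), ← modOne_ofReal (hf j), modOne, modOne, he]
    rcases (ω.adj_iff i j).1 hij with h' | h'
    · exact (h _ _ h').ne he'
    · exact (h _ _ h').ne' he'
  refine ⟨hx, Eq.symm (AcyclicOrientation.eq_of_arrow_imp fun i j hij => ?_)⟩
  refine ⟨?_, ?_⟩
  · exact (ω.adj_iff i j).2 (Or.inl hij)
  · rw [modOne_ofReal (hf i), modOne_ofReal (hf j)]
    exact h i j hij

theorem realizations_eq_image (ω : AcyclicOrientation G) :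
    realizations ω = ofReal '' {f | (∀ i, f i ∈ Set.Ico (0 : ℝ) 1) ∧
      ∀ i j, ω.arrow i j → f i < f j} := by
  ext x
  constructor
  · rintro ⟨hx, rfl⟩
    exact ⟨modOne x, ⟨modOne_mem_Ico x, fun i j h => h.2⟩, ofReal_modOne x⟩
  · rintro ⟨f, ⟨h1, h2⟩, rfl⟩
    exact ofReal_mem_realizations h1 h2

theorem isPreconnected_realizations (ω : AcyclicOrientation G) :
    IsPreconnected (realizations ω) := by
  rw [realizations_eq_image]
  refine IsPreconnected.image (Convex.isPreconnected ?_) _ continuous_ofReal.continuousOn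
  intro f hf g hg a b ha hb hab
  refine ⟨fun i => convex_Ico (0 : ℝ) 1 (hf.1 i) (hg.1 i) ha hb hab, fun i j hij => ?_⟩
  have h1 := hf.2 i j hij
  have h2 := hg.2 i j hij
  simp only [Pi.add_apply, Pi.smul_apply, smul_eq_mul]
  -- Strictness needs a positive weight on one of the two inequalities.
  rcases ha.eq_or_lt with rfl | ha'
  · have : b = 1 := by linarith
    subst this
    linarith
  · have := mul_lt_mul_of_pos_left h1 ha'
    have := mul_le_mul_of_nonneg_left h2.le hb
    linarith

theorem realizations_nonempty [Finite V] (ω : AcyclicOrientation G) :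
    (realizations ω).Nonempty := by
  obtain ⟨g, -, h1, h2⟩ := ω.exists_injective_labelling
  exact ⟨_, ofReal_mem_realizations h1 h2⟩

/-- A flip is realized by a translation along the diagonal. -/
theorem exists_rotate_mem_realizations [Finite V] {ω ω' : AcyclicOrientation G}
    (h : ω.IsFlip ω') : ∃ x ∈ realizations ω, ∃ c, rotate x c ∈ realizations ω' := by
  classical
  obtain ⟨v, hv, hflip⟩ := h
  obtain ⟨g, -, h1, h2⟩ := ω.exists_injective_labelling
  -- The source `v` sits at 0 and all other vertices in `[1/2, 1)`. Translation by -1/4 carries `v`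
  -- alone across 0, to 3/4, and the others into `[1/4, 3/4)`, so `v` becomes the largest.
  refine ⟨ofReal fun i => if i = v then 0 else 1 / 2 + g i / 2,
    ofReal_mem_realizations ?_ ?_, ((-(1 / 4) : ℝ) : UnitAddCircle), ?_⟩
  · intro i
    have := h1 i
    split_ifs
    · simp
    · exact ⟨by linarith [this.1], by linarith [this.2]⟩
  · intro i j hij
    have hj : j ≠ v := fun h => hv i (h ▸ hij)
    have := h2 i j hij
    have := (h1 j).1
    simp only [hj, if_false]
    split_ifs <;> linarith
  · have heq : rotate (ofReal fun i => if i = v then 0 else 1 / 2 + g i / 2)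
        ((-(1 / 4) : ℝ) : UnitAddCircle) =
        ofReal fun i => if i = v then 3 / 4 else 1 / 4 + g i / 2 := by
      funext i
      simp only [rotate, ofReal]
      rw [← AddCircle.coe_add]
      split_ifs
      · have : (3 / 4 : ℝ) = 0 + -(1 / 4) + 1 := by norm_num
        rw [this, AddCircle.coe_add_period]
      · congr 1; ring
    rw [heq]
    refine ofReal_mem_realizations ?_ ?_
    · intro i
      have := h1 i
      split_ifs
      · norm_num
      · exact ⟨by linarith [this.1], by linarith [this.2]⟩
    · intro i j hij
      have hi := (h1 i).2
      rcases (hflip i j).1 hij with ⟨⟨hi', hj'⟩, h⟩ | ⟨h, h'⟩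
      · have := h2 i j h
        simp only [hi', hj', if_false]
        linarith
      · have hi' : i ≠ v := fun h => hv j (h ▸ h')
        obtain rfl := h.resolve_left hi'
        simp only [hi', if_false, if_true]
        linarith

/-- Points that determine torically equivalent orientations lie in the same toric chamber. -/
theorem connectedComponentIn_eq_of_toricEquiv [Finite V] {ω ω' : AcyclicOrientation G}
    (h : ω.ToricEquiv ω') {x y : Torus V} (hx : x ∈ realizations ω) (hy : y ∈ realizations ω') :
    connectedComponentIn (arrangementCompl G) x = connectedComponentIn (arrangementCompl G) y := by
  have same : ∀ {α : AcyclicOrientation G} {a b : Torus V}, a ∈ realizations α →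
      b ∈ realizations α → connectedComponentIn (arrangementCompl G) a =
        connectedComponentIn (arrangementCompl G) b := fun {α a b} ha hb =>
    connectedComponentIn_eq ((isPreconnected_realizations α).subset_connectedComponentIn ha
      (fun _ h => h.1) hb)
  induction h generalizing x y with
  | refl => exact same hx hy
  | symm _ _ _ ih => exact (ih hy hx).symm
  | trans _ β _ _ _ ih₁ ih₂ =>
    obtain ⟨z, hz⟩ := realizations_nonempty β
    exact (ih₁ hx hz).trans (ih₂ hz hy)
  | rel α β h =>
    obtain ⟨z, hz, c, hc⟩ := exists_rotate_mem_realizations h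
    rw [same hx hz, ← same hc hy]
    exact connectedComponentIn_eq (rotate_mem_connectedComponentIn hz.1 c)

/-- Compressing a labelling so that an order ideal and its complement concentrate near two
different values. -/
theorem ofReal_compress_mem_realizations {ω : AcyclicOrientation G} {g : V → ℝ}
    (h1 : ∀ i, g i ∈ Set.Ico (0 : ℝ) 1) (h2 : ∀ i j, ω.arrow i j → g i < g j) {I : Set V}
    [DecidablePred (· ∈ I)] (hI : ω.IsOrderIdeal I) {t : ℝ} (ht : 0 < t) (ht' : t ≤ 1 / 4) :
    ofReal (fun i => (if i ∈ I then 1 / 4 else 1 / 2) + t * g i) ∈ realizations ω := by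
  -- With `t ≤ 1/4`, the ideal stays in `[1/4, 1/2)` and its complement in `[1/2, 3/4)`.
  have hb : ∀ i, 0 ≤ t * g i ∧ t * g i < 1 / 4 := fun i =>
    ⟨mul_nonneg ht.le (h1 i).1, by nlinarith [(h1 i).1, (h1 i).2]⟩
  refine ofReal_mem_realizations (fun i => ?_) fun i j hij => ?_
  · have := hb i
    constructor <;> split_ifs <;> linarith
  · have := mul_lt_mul_of_pos_left (h2 i j hij) ht
    have hi := hb i
    have hj := hb j
    have := AcyclicOrientation.isOrderIdeal_iff.1 hI i j hij
    split_ifs <;> first | linarith | tauto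

/-- A vector of the flat factors through membership in `I`, a map to the two-element type `Prop`. An
empty block does no harm. -/
theorem finrank_centralFlat_le_two {π : Setoid V} {I : Set V}
    (hπ : ∀ i j, π i j ↔ (i ∈ I ↔ j ∈ I)) : Module.finrank ℝ (centralFlat π) ≤ 2 := by
  have hle : centralFlat π ≤
      LinearMap.range (LinearMap.funLeft ℝ ℝ (fun i : V => (i ∈ I : Prop))) := by
    intro x hx
    have hf : Function.FactorsThrough x (fun i : V => (i ∈ I : Prop)) := fun i j h =>
      hx i j ((hπ i j).2 (iff_of_eq h))
    exact ⟨Function.extend (fun i : V => (i ∈ I : Prop)) x fun _ => 0,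
      hf.extend_comp (fun _ => (0 : ℝ))⟩
  calc _ ≤ _ := Submodule.finrank_mono hle
    _ ≤ _ := LinearMap.finrank_range_le _
    _ = 2 := by simp [Module.finrank_fintype_fun_eq_card]

end Torus

/-- A subset of a finite type, listed in increasing order of an injective labelling. -/
theorem exists_list_pairwise_lt {V : Type*} [Finite V] {f : V → ℝ} (hf : Function.Injective f)
    (S : Set V) : ∃ l : List V, (∀ v, v ∈ l ↔ v ∈ S) ∧ l.Pairwise (fun i j => f i < f j) := by
  let _ : LinearOrder V := LinearOrder.lift' f hf
  refine ⟨(Set.toFinite S).toFinset.sort, fun v => by simp, ?_⟩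
  exact (Finset.sortedLT_sort _).pairwise

/-! ### Toric filters and total toric extensions. -/

namespace ToricPoset

variable {V : Type*} {G : SimpleGraph V} {ω : AcyclicOrientation G} {P : ToricPoset V}

open Torus

theorem IsToricPosetOf.exists_chamber_eq (hP : P.IsToricPosetOf G ω) :
    ∃ (x : Torus V) (hx : x ∈ arrangementCompl G), orientation G x hx ∈ ω.toricClass ∧
      P.chamber = connectedComponentIn (arrangementCompl G) x := by
  obtain ⟨⟨z, hz, hz'⟩, x, hx, hxP, hω⟩ := hP
  exact ⟨x, hx, hω, by rw [hz'] at hxP ⊢; exact connectedComponentIn_eq hxP⟩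

theorem IsToricPosetOf.orientation_mem [Finite V] (hP : P.IsToricPosetOf G ω) {y : Torus V}
    (hy : y ∈ P.chamber) :
    ∃ hy : y ∈ arrangementCompl G, orientation G y hy ∈ ω.toricClass := by
  obtain ⟨x, hx, hω, hc⟩ := hP.exists_chamber_eq
  rw [hc] at hy
  exact ⟨connectedComponentIn_subset _ _ hy, Relation.EqvGen.trans _ _ _ hω
    (toricEquiv_orientation_of_mem_connectedComponentIn hx _ hy)⟩

/-- With `orientation_mem`, this makes the chamber the union of the realizations of the orientations
in the class. -/
theorem IsToricPosetOf.realizations_subset [Finite V] (hP : P.IsToricPosetOf G ω)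
    {ω' : AcyclicOrientation G} (h : ω' ∈ ω.toricClass) : realizations ω' ⊆ P.chamber := by
  obtain ⟨x, hx, hω, hc⟩ := hP.exists_chamber_eq
  intro y hy
  rw [hc, connectedComponentIn_eq_of_toricEquiv (.trans _ _ _ (.symm _ _ hω) h) ⟨hx, rfl⟩ hy]
  exact mem_connectedComponentIn hy.1

theorem IsToricPosetOf.rotate_mem (hP : P.IsToricPosetOf G ω) {y : Torus V}
    (hy : y ∈ P.chamber) (c : UnitAddCircle) : rotate y c ∈ P.chamber := by
  obtain ⟨x, hx, hω, hc⟩ := hP.exists_chamber_eq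
  rw [hc] at hy ⊢
  rw [connectedComponentIn_eq hy]
  exact rotate_mem_connectedComponentIn (connectedComponentIn_subset _ _ hy) c

/-- If the flat of the two-block partition `{I, Iᶜ}` meets the closed chamber in a point whose two
coordinates differ, then `I` is an order ideal of some orientation in the class. -/
theorem IsToricPosetOf.exists_isOrderIdeal_of_mem_closure [Finite V]
    (hP : P.IsToricPosetOf G ω) {I : Set V} {x : Torus V} (hx : x ∈ closure P.chamber)
    {a b : UnitAddCircle} (hab : a ≠ b) (ha : ∀ i ∈ I, x i = a) (hb : ∀ i ∉ I, x i = b) :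
    ∃ ω' ∈ ω.toricClass, ω'.IsOrderIdeal I := by
  obtain ⟨d, hd, hd'⟩ : ∃ d ∈ Set.Ioo (0 : ℝ) 1, (d : UnitAddCircle) = b - a := by
    have h1 := modOne_mem_Ico (fun _ : Unit => b - a) ()
    have h2 := coe_modOne (fun _ : Unit => b - a) ()
    refine ⟨_, ⟨lt_of_le_of_ne h1.1 fun h => ?_, h1.2⟩, h2⟩
    rw [← h, AddCircle.coe_zero] at h2
    exact hab (sub_eq_zero.1 h2.symm).symm
  obtain ⟨hd0, hd1⟩ := hd
  -- This translation places the two values at `(1 - d) / 2` and `(1 + d) / 2`, symmetric about 1/2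
  -- and away from 0.
  set c : UnitAddCircle := (((1 - d) / 2 : ℝ) : UnitAddCircle) - a with hc
  have hI : ∀ i ∈ I, modOne (rotate x c) i = (1 - d) / 2 := fun i hi =>
    modOne_eq ⟨by linarith, by linarith⟩ (by rw [rotate, ha i hi, hc]; abel)
  have hI' : ∀ i ∉ I, modOne (rotate x c) i = (1 + d) / 2 := fun i hi =>
    modOne_eq ⟨by linarith, by linarith⟩ (by
      have : (1 + d) / 2 = (1 - d) / 2 + d := by ring
      rw [rotate, hb i hi, hc, this, AddCircle.coe_add, hd']
      abel)
  have hne : ∀ i, rotate x c i ≠ 0 := by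
    intro i h
    have h0 : modOne (rotate x c) i = 0 := modOne_eq (by simp) (by rw [h, AddCircle.coe_zero])
    by_cases hi : i ∈ I
    · rw [hI i hi] at h0; linarith
    · rw [hI' i hi] at h0; linarith
  have hcont : ∀ i, ContinuousAt (fun y => modOne (rotate y c) i) x := fun i =>
    ContinuousAt.comp (f := fun y => rotate y c) (continuousAt_modOne (hne i))
      (continuous_rotate_left c).continuousAt
  have key : ∀ᶠ y in nhds x, ∀ i, (i ∈ I → modOne (rotate y c) i < 1 / 2) ∧
      (i ∉ I → 1 / 2 < modOne (rotate y c) i) := by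
    refine Filter.eventually_all.2 fun i => ?_
    by_cases hi : i ∈ I
    · filter_upwards [(hcont i).eventually_lt_const (u := 1 / 2)
        ((hI i hi).trans_lt (by linarith))] with y hy
      exact ⟨fun _ => hy, fun h => absurd hi h⟩
    · filter_upwards [(hcont i).eventually_const_lt (u := 1 / 2)
        (lt_of_lt_of_eq (by linarith) (hI' i hi).symm)] with y hy
      exact ⟨fun h => absurd h hi, fun _ => hy⟩
  obtain ⟨y, hyP, hy⟩ := ((mem_closure_iff_frequently.1 hx).and_eventually key).exists
  obtain ⟨hyG, hyω⟩ := hP.orientation_mem (hP.rotate_mem hyP c)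
  refine ⟨_, hyω, AcyclicOrientation.isOrderIdeal_iff.2 fun i j hij hj => ?_⟩
  by_contra hi
  exact lt_asymm hij.2 (((hy j).1 hj).trans ((hy i).2 hi))

theorem IsToricPosetOf.exists_isOrderIdeal_of_isToricFilter [Finite V]
    (hP : P.IsToricPosetOf G ω) {I : Set V} (hI : P.IsToricFilter I) :
    ∃ ω' ∈ ω.toricClass, ω'.IsOrderIdeal I := by
  by_cases htriv : ∀ i j, (i ∈ I ↔ j ∈ I)
  · exact ⟨ω, .refl _, AcyclicOrientation.isOrderIdeal_iff.2 fun i j _ => (htriv i j).2⟩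
  obtain ⟨π, hπ, hcl, -⟩ := hI
  obtain ⟨x, hx, hx'⟩ : ∃ x ∈ P.closedFace π, ¬ ∀ i j, x i = x j := by
    by_contra! hcon
    -- If the face had only diagonal points, the one-block partition would cut out the same face, so
    -- the closed partition `π` would be trivial.
    have htop : (⊤ : Setoid V) ≤ π := by
      rw [← hcl]
      refine le_sSup ⟨le_top, Set.Subset.antisymm (fun x hx => ?_) fun x hx => ?_⟩
      · exact ⟨hx.1, fun i j _ => hx.2 i j trivial⟩
      · exact ⟨hx.1, fun i j _ => hcon x hx i j⟩
    exact htriv fun i j => (hπ i j).1 (htop trivial)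
  have hflat : ∀ i j, (i ∈ I ↔ j ∈ I) → x i = x j := fun i j h => hx.2 i j ((hπ i j).2 h)
  obtain ⟨i, j, hi, hj, hij⟩ : ∃ i j, i ∈ I ∧ j ∉ I ∧ x i ≠ x j := by
    push Not at hx'
    obtain ⟨i, j, hij⟩ := hx'
    by_cases hi : i ∈ I <;> by_cases hj : j ∈ I
    · exact absurd (hflat i j (by tauto)) hij
    · exact ⟨i, j, hi, hj, hij⟩
    · exact ⟨j, i, hj, hi, hij.symm⟩
    · exact absurd (hflat i j (by tauto)) hij
  exact hP.exists_isOrderIdeal_of_mem_closure hx.1 hij (fun k hk => hflat k i (by tauto))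
    fun k hk => hflat k j (by tauto)

/-- As the compression parameter tends to 0, points of the chamber converge to a face point with
value 1/4 on `I` and 1/2 off it. No coarsening with the same face can merge these two blocks. -/
theorem IsToricPosetOf.isToricFilter_of_isOrderIdeal [Finite V] (hP : P.IsToricPosetOf G ω)
    {ω' : AcyclicOrientation G} (hω : ω' ∈ ω.toricClass) {I : Set V} (hI : ω'.IsOrderIdeal I) :
    P.IsToricFilter I := by
  classical
  obtain ⟨g, -, h1, h2⟩ := ω'.exists_injective_labelling
  let π : Setoid V := Setoid.comap (fun i : V => (i ∈ I : Prop)) ⊥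
  have hπ : ∀ i j, π i j ↔ (i ∈ I ↔ j ∈ I) := fun i j => eq_iff_iff
  let F : ℝ → Torus V := fun t => ofReal fun i => (if i ∈ I then 1 / 4 else 1 / 2) + t * g i
  have hF : Continuous F := continuous_ofReal.comp (by fun_prop)
  have hx : F 0 ∈ closure P.chamber := by
    refine mem_closure_of_tendsto (b := nhdsWithin 0 (Set.Ioi 0))
      (hF.continuousAt.tendsto.mono_left nhdsWithin_le_nhds) ?_
    filter_upwards [Ioo_mem_nhdsGT (show (0 : ℝ) < 1 / 4 by norm_num)] with t ht
    exact hP.realizations_subset hω (ofReal_compress_mem_realizations h1 h2 hI ht.1 ht.2.le)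
  have hmod : ∀ i, modOne (F 0) i = if i ∈ I then 1 / 4 else 1 / 2 := fun i => by
    have : F 0 = ofReal fun i => if i ∈ I then 1 / 4 else 1 / 2 := by simp [F]
    rw [this, modOne_ofReal]
    split_ifs <;> norm_num
  have hface : F 0 ∈ P.closedFace π := by
    refine ⟨hx, fun i j hij => ?_⟩
    rw [← coe_modOne (F 0) i, ← coe_modOne (F 0) j, hmod, hmod]
    simp only [(hπ i j).1 hij]
  have hcl : P.IsClosedPartition π := by
    refine le_antisymm (sSup_le ?_) (le_sSup ⟨le_rfl, rfl⟩)
    rintro σ ⟨-, hσ⟩ i j hij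
    have heq : F 0 i = F 0 j := by
      rw [← hσ] at hface
      exact hface.2 i j hij
    have hm : modOne (F 0) i = modOne (F 0) j := by rw [modOne, modOne, heq]
    rw [hmod, hmod] at hm
    rw [hπ]
    split_ifs at hm with hi hj hj
    · tauto
    · norm_num at hm
    · norm_num at hm
    · tauto
  refine ⟨π, hπ, hcl, ?_⟩
  rw [faceDim, hcl]
  exact finrank_centralFlat_le_two hπ

theorem IsToricPosetOf.exists_isTotalExtension_of_isOrderIdeal [Finite V]
    (hP : P.IsToricPosetOf G ω) {ω' : AcyclicOrientation G} (hω : ω' ∈ ω.toricClass) {I : Set V}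
    (hI : ω'.IsOrderIdeal I) :
    ∃ P' : ToricPoset V, P'.IsTotalExtension P ∧
      ∃ w : Cycle V, P'.HasCyclicOrder w ∧ w.IsConsecutive I := by
  classical
  obtain ⟨g, hg, h1, h2⟩ := ω'.exists_injective_labelling
  -- Compression with `t = 1/4`: `f` inherits injectivity from `g`, so its point avoids the complete
  -- arrangement, and `I` precedes its complement.
  set f : V → ℝ := fun i => (if i ∈ I then 1 / 4 else 1 / 2) + 1 / 4 * g i with hf
  have hfI : ∀ i ∈ I, f i < 1 / 2 := fun i hi => by
    simp only [hf, hi, if_true]; linarith [(h1 i).2]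
  have hfI' : ∀ i ∉ I, 1 / 2 ≤ f i := fun i hi => by
    simp only [hf, hi, if_false]; linarith [(h1 i).1]
  have hfmem : ∀ i, f i ∈ Set.Ico (0 : ℝ) 1 := fun i => by
    have := h1 i
    constructor <;> simp only [hf] <;> split_ifs <;> linarith [this.1, this.2]
  have hinj : Function.Injective f := by
    intro i j hij
    by_cases hi : i ∈ I <;> by_cases hj : j ∈ I
    · exact hg (by simpa [hf, hi, hj] using hij)
    · linarith [hfI i hi, hfI' j hj]
    · linarith [hfI j hj, hfI' i hi]
    · exact hg (by simpa [hf, hi, hj] using hij)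
  have hxP : ofReal f ∈ P.chamber := hP.realizations_subset hω
    (ofReal_compress_mem_realizations h1 h2 hI (by norm_num) le_rfl)
  have hxT : ofReal f ∈ arrangementCompl (⊤ : SimpleGraph V) := by
    intro i j hij h
    have : modOne (ofReal f) i = modOne (ofReal f) j := by rw [modOne, modOne, h]
    rw [modOne_ofReal (hfmem i), modOne_ofReal (hfmem j)] at this
    exact hij (hinj this)
  let P' : ToricPoset V := ⟨connectedComponentIn (arrangementCompl ⊤) (ofReal f), ⊤, _, hxT, rfl⟩
  obtain ⟨l₁, hl₁, hp₁⟩ := exists_list_pairwise_lt hinj I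
  obtain ⟨l₂, hl₂, hp₂⟩ := exists_list_pairwise_lt hinj Iᶜ
  refine ⟨P', ⟨⟨_, hxT, rfl⟩, ?_⟩, (l₁ ++ l₂ : List V), ?_, l₁, l₂, rfl, fun v => (hl₁ v).1,
    fun v => (hl₂ v).1⟩
  · obtain ⟨x, hx, -, hc⟩ := hP.exists_chamber_eq
    rw [hc] at hxP ⊢
    rw [connectedComponentIn_eq hxP]
    exact connectedComponentIn_mono _ fun y hy i j hij => hy i j hij.ne
  · intro y hy
    have hyT : y ∈ arrangementCompl (⊤ : SimpleGraph V) := connectedComponentIn_subset _ _ hy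
    have hequiv := toricEquiv_orientation_of_mem_connectedComponentIn hxT hyT hy
    have hsorted : (l₁ ++ l₂).Pairwise (fun i j => f i < f j) := by
      rw [List.pairwise_append]
      exact ⟨hp₁, hp₂, fun i hi j hj =>
        (hfI i ((hl₁ i).1 hi)).trans_le (hfI' j ((hl₂ j).1 hj))⟩
    -- The sorted list at `ofReal f` is carried to `y` along the toric equivalence, up to rotation.
    obtain ⟨l, hlw, hl, hp⟩ := (AcyclicOrientation.exists_sorted_list_congr
      (w := (l₁ ++ l₂ : List V)) hequiv).1 ⟨l₁ ++ l₂, rfl, fun v => by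
        rw [List.mem_append, hl₁, hl₂]; exact em _, hsorted.imp fun {i j} hij => by
          refine ⟨fun h => hij.ne (congrArg f h), ?_⟩
          rwa [modOne_ofReal (hfmem i), modOne_ofReal (hfmem j)]⟩
    exact ⟨l, hlw, hl, hp.imp fun h => h.2⟩

theorem IsToricPosetOf.exists_isOrderIdeal_of_isTotalExtension [Finite V]
    (hP : P.IsToricPosetOf G ω) {P' : ToricPoset V} (hP' : P'.IsTotalExtension P) {w : Cycle V}
    (hw : P'.HasCyclicOrder w) {I : Set V} (hI : w.IsConsecutive I) :
    ∃ ω' ∈ ω.toricClass, ω'.IsOrderIdeal I := by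
  obtain ⟨⟨x, hxT, hx⟩, hsub⟩ := hP'
  have hxP' : x ∈ P'.chamber := hx ▸ mem_connectedComponentIn hxT
  obtain ⟨hxG, hxω⟩ := hP.orientation_mem (hsub hxP')
  obtain ⟨l, hlw, hl, hp⟩ := hw x hxP'
  obtain ⟨l₁, l₂, hlw', hl₁, hl₂⟩ := hI
  obtain ⟨s, t, rfl, hst⟩ : ∃ s t, l = s ++ t ∧ t ++ s = l₁ ++ l₂ := by
    obtain ⟨n, hn⟩ := Cycle.coe_eq_coe.1 (hlw.trans hlw'.symm)
    rw [List.rotate_eq_drop_append_take_mod] at hn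
    exact ⟨_, _, (List.take_append_drop _ l).symm, hn⟩
  obtain ⟨hs, ht, hlt⟩ := List.pairwise_append.1 hp
  have hts : ∀ i ∈ t, i ∉ s := fun i hi hi' => lt_irrefl _ (hlt i hi' i hi)
  have hS : (orientation G x hxG).IsOrderIdeal {v | v ∈ s} :=
    AcyclicOrientation.isOrderIdeal_iff.2 fun i j hij hj =>
      (List.mem_append.1 (hl i)).resolve_right fun hi => lt_asymm hij.2 (hlt j hj i hi)
  -- The given representative of the cyclic order is `t ++ s`, while `x` is sorted as `s ++ t`.
  -- Flipping across the initial segment `s` puts `s` after `t`.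
  refine ⟨_, Relation.EqvGen.trans _ _ _ hxω (AcyclicOrientation.toricEquiv_flipAcross _ _ hS), ?_⟩
  -- No arrow runs backwards along `t ++ s`. The negative form is needed because vertices not
  -- adjacent in `G` carry no arrow.
  have hpair : (t ++ s).Pairwise
      fun i j => ¬ ((orientation G x hxG).flipAcross _ hS).arrow j i := by
    rw [List.pairwise_append]
    refine ⟨ht.imp_of_mem fun {i j} hi hj hij h => ?_,
      hs.imp_of_mem fun {i j} hi hj hij h => ?_, fun i hi j hj h => ?_⟩
    · rcases h with ⟨-, h⟩ | ⟨h, -⟩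
      · exact lt_asymm hij h.2
      · exact h (iff_of_false (hts j hj) (hts i hi))
    · rcases h with ⟨-, h⟩ | ⟨h, -⟩
      · exact lt_asymm hij h.2
      · exact h (iff_of_true hj hi)
    · rcases h with ⟨h, -⟩ | ⟨-, h⟩
      · exact hts i hi (h.1 hj)
      · exact lt_asymm h.2 (hlt j hj i hi)
  rw [hst, List.pairwise_append] at hpair
  have hmem : ∀ v, v ∈ l₁ ∨ v ∈ l₂ := fun v => by
    rw [← List.mem_append, ← hst, List.mem_append, or_comm, ← List.mem_append]
    exact hl v
  refine AcyclicOrientation.isOrderIdeal_iff.2 fun i j hij hj => ?_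
  have hj' := (hmem j).resolve_right fun h => hl₂ j h hj
  exact hl₁ i ((hmem i).resolve_right fun hi => hpair.2.2 j hj' i hi hij)

end ToricPoset

theorem proposition6p2 {V : Type*} [Finite V] (G : SimpleGraph V) (ω : AcyclicOrientation G)
    (P : ToricPoset V) (hP : P.IsToricPosetOf G ω) (I : Set V) :
    List.TFAE [
      P.IsToricFilter I,
      ∃ ω' ∈ ω.toricClass, ω'.IsOrderIdeal I,
      ∃ ω'' ∈ ω.toricClass, ω''.IsOrderFilter I,
      ∃ P' : ToricPoset V, P'.IsTotalExtension P ∧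
        ∃ w : Cycle V, P'.HasCyclicOrder w ∧ w.IsConsecutive I] := by
  tfae_have 1 → 2 := hP.exists_isOrderIdeal_of_isToricFilter
  tfae_have 2 → 1 := fun ⟨_, hω, hI⟩ => hP.isToricFilter_of_isOrderIdeal hω hI
  tfae_have 2 ↔ 3 := ω.exists_isOrderIdeal_iff_exists_isOrderFilter I
  tfae_have 2 → 4 := fun ⟨_, hω, hI⟩ => hP.exists_isTotalExtension_of_isOrderIdeal hω hI
  tfae_have 4 → 2 := fun ⟨_, hP', _, hw, hI⟩ =>
    hP.exists_isOrderIdeal_of_isTotalExtension hP' hw hI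
  tfae_finish
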